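/- **Setting.** A finite 2-complex with cyclic structure consists of finite sets $V$ (vertices), $E$ (edges), $F$ (faces), maps $\partial_+,\partial_-\colon E\to V$ (end point and starting point), and for each face $f$ a number $N(f)\ge 1$, boundary edges $\partial_1f,\dots,\partial_{N(f)}f\in E$ and signs $\epsilon_1f,\dots,\epsilon_{N(f)}f\in\{+1,-1\}$ such that, with indices $k$ read cyclically modulo $N(f)$, $$\partial_{-\epsilon_kf}\,\partial_kf=\partial_{\epsilon_{k+1}f}\,\partial_{k+1}f\qquad(1\le k\le N(f)).$$ The *corners* of $f$ are its boundary vertices counted as often as the boundary path visits them: the corner $c\in\{1,\dots,N(f)\}$ is the vertex $\partial_{\epsilon_cf}\partial_cf=\partial_{-\epsilon_{c-1}f}\partial_{c-1}f$. Let $e_\pm$ be the set of occurrences $(f,k)$ with $\partial_kf=e$ and $\epsilon_kf=\pm1$, let $\delta e\subseteq F$ be the set of faces that contain $e$ in their boundary, and $\partial f\subseteq E$ the set of boundary edges of $f$. For an occurrence $(f,k)$ of $e$ and a sign $\sigma$, the corner of $f$ at $\partial_\sigma e$ is $k$ if $\sigma=\epsilon_kf$ and $k+1$ otherwise. For $j\in\frac12\mathbb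 N_0$ let $t^{(j)}_{mn}$, $1\le m,n\le 2j+1$, be the matrix elements in an orthonormal basis of the unitary irreducible representation of $SU(2)\cong S^3$ of dimension $2j+1$, and $\chi^{(j)}=\sum_n t^{(j)}_{nn}$ its character; $dg$ is the Haar measure of total mass $1$. The Barrett–Crane intertwiner $\bigotimes_r V_{(j_r,j_r^*)}\to\bigotimes_s V_{(k_s,k_s^*)}$ has the matrix elements $$I_{(m_1n_1)\dots;(p_1q_1)\dots}=\int_{SU(2)}\overline{\prod_r t^{(j_r)}_{p_rq_r}(x)}\,\prod_s t^{(k_s)}_{m_sn_s}(x)\,dx .$$ Given a face amplitude $\hat w_j\in\mathbb C$ and edge amplitudes $\hat A^{(e)}\big((j_f)_{f\in\delta e}\big)\in\mathbb C$, the partition function of the (generalized) Barrett–Crane model is $$Z=\sum_{(j_f)\in(\frac12\mathbb N_0)^F}\Big(\prod_{f}\hat w_{j_f}\Big)\Big(\prod_{e}\hat A^{(e)}\big((j_f)_{f\in\delta e}\big)\Big)\sum_{n,m}\ \prod_{e}I^{(+,e)}\,I^{(-,e)},$$ where the inner sum runs over one pair $(n(f,c),m(f,c))\in\{1,\dots,2j_f+1\}^2$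 for each face $f$ and each corner $c$ of $f$. Here $I^{(+,e)}$ is the matrix element of the intertwiner from the occurrences in $e_-$ to those in $e_+$, taken at the index pairs of the corners at $\partial_+e$, and $I^{(-,e)}$ that of the intertwiner from $e_+$ to $e_-$, taken at the index pairs of the corners at $\partial_-e$. **Theorem (dual variables).** For variables $(g_e^{(+)},g_e^{(-)})\in SU(2)\times SU(2)$, $e\in E$, put for each face $f$ and $1\le k\le N(f)$ $$g_{f,k}^{(+)}:=g_{\partial_kf}^{(\epsilon_kf)},\qquad g_{f,k}^{(-)}:=g_{\partial_kf}^{(-\epsilon_kf)},$$ so that $g_{f,k}^{(\pm)}=g_{\partial_kf}^{(\pm)}$ if $\epsilon_kf=+1$, and the two are exchanged if $\epsilon_kf=-1$. Suppose that the series over $(j_f)\in(\frac12\mathbb N_0)^F$ $$W(g)=\sum_{(j_f)}\Big(\prod_{e}\hat A^{(e)}\big((j_f)_{f\in\delta e}\big)\Big)\prod_{f}\Big[\hat w_{j_f}\prod_{c=1}^{N(f)}\chi^{(j_f)}\big(g_{f,c}^{(+)}\,(g_{f,c-1}^{(-)})^{-1}\big)\Big]$$ converges unconditionally in $L^1(SU(2)^E\times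 SU(2)^E)$ to $W$ (for instance unconditionally in $L^2$, or with a convergent sum of $L^1$-norms). Then the series $Z$ converges absolutely, and $$Z=\Big(\prod_{e\in E}\int_{SU(2)}dg_e^{(+)}\int_{SU(2)}dg_e^{(-)}\Big)\,W(g).$$ If moreover the edge amplitude factorizes, $\hat A^{(e)}\big((j_f)_{f\in\delta e}\big)=\prod_{f\in\delta e}\hat v_{j_f}$ with $\hat v_j\in\mathbb C$, and for each face $f$ the series $$\varphi_f\big(g_1^{(+)},g_1^{(-)},\dots,g_N^{(+)},g_N^{(-)}\big)=\sum_{j\in\frac12\mathbb N_0}\hat w_j\,\hat v_j^{|\partial f|}\,\chi^{(j)}\big(g_2^{(+)}(g_1^{(-)})^{-1}\big)\,\chi^{(j)}\big(g_3^{(+)}(g_2^{(-)})^{-1}\big)\cdots\chi^{(j)}\big(g_1^{(+)}(g_N^{(-)})^{-1}\big),\quad N=N(f),$$ evaluated at $g_k^{(\pm)}=g_{f,k}^{(\pm)}$, converges unconditionally to $\varphi_f$ at least in measure on $SU(2)^E\times SU(2)^E$, then the Boltzmann weight is local: $\prod_f\varphi_f$ is integrable and $$Z=\Big(\prod_{e\in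 E}\int_{SU(2)}dg_e^{(+)}\int_{SU(2)}dg_e^{(-)}\Big)\,\prod_{f\in F}\varphi_f\big(g_{f,1}^{(+)},g_{f,1}^{(-)},\dots,g_{f,N(f)}^{(+)},g_{f,N(f)}^{(-)}\big).$$ -/

import Mathlib

open MeasureTheory Filter Topology

noncomputable section

namespace BarrettCrane

/-! ### The group `SU(2) ≅ S³`, its Haar measure and its irreducible representations -/

/-- The compact group `SU(2)`, which is also the model of the sphere `S³`. -/
abbrev SU2 : Type := Matrix.specialUnitaryGroup (Fin 2) ℂ

instance : MeasurableSpace SU2 := borel SU2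

instance : BorelSpace SU2 := ⟨rfl⟩

instance : IsTopologicalGroup SU2 where
  continuous_mul := continuous_mul
  continuous_inv := by
    refine Continuous.subtype_mk (f := fun x : SU2 => star x.1) ?_ _
    exact continuous_star.comp continuous_subtype_val

instance : CompactSpace SU2 := by
  refine isCompact_iff_compactSpace.mp ?_
  have hc : IsClosed ((Matrix.specialUnitaryGroup (Fin 2) ℂ : Submonoid _) :
      Set (Matrix (Fin 2) (Fin 2) ℂ)) := by
    have : ((Matrix.specialUnitaryGroup (Fin 2) ℂ : Submonoid _) :
        Set (Matrix (Fin 2) (Fin 2) ℂ)) = {A | A * star A = 1} ∩ {A | A.det = 1} := by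
      ext A
      simp [Matrix.mem_specialUnitaryGroup_iff, Matrix.mem_unitaryGroup_iff]
    rw [this]
    refine IsClosed.inter ?_ ?_
    · exact isClosed_eq (continuous_id.mul continuous_star) continuous_const
    · exact isClosed_eq (Continuous.matrix_det continuous_id) continuous_const
  have hb : IsCompact (Set.univ.pi fun _ : Fin 2 => Set.univ.pi fun _ : Fin 2 =>
      Metric.closedBall (0 : ℂ) 1) :=
    isCompact_univ_pi fun _ => isCompact_univ_pi fun _ => isCompact_closedBall _ _
  refine hb.of_isClosed_subset hc ?_
  intro A hA i _ j _
  rw [mem_closedBall_zero_iff]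
  exact entry_norm_bound_of_unitary (Matrix.specialUnitaryGroup_le_unitaryGroup hA) i j

/-- The Haar measure of `SU(2)`, normalized to total mass `1`. -/
def haarSU2 : Measure SU2 := Measure.haarMeasure ⊤

/-- A spin `j ∈ {0, 1/2, 1, …}` is encoded by the natural number `2 j`;
the representation `V_j` has dimension `2 j + 1`. -/
abbrev Spin : Type := ℕ

/-- The representation functions `t^{(j)}_{mk}` with `n = 2 j`: the unitary irreducible
representation of `SU(2)` on homogeneous polynomials of degree `n` in two variables `x, y`,
where `g` substitutes `x ↦ g₀₀ x + g₁₀ y` and `y ↦ g₀₁ x + g₁₁ y`, written in the orthonormal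
basis `√(n choose k) x^(n-k) y^k`, `0 ≤ k ≤ n`.  The coefficient of `x^(n-m) y^m` in the image of
`x^(n-k) y^k` is read off after setting `x = 1`, `y = X`. -/
def repMatrix (n : Spin) (g : SU2) : Matrix (Fin (n + 1)) (Fin (n + 1)) ℂ := fun m k =>
  (Real.sqrt ((n.choose k : ℝ) / (n.choose m : ℝ)) : ℂ) *
    ((Polynomial.C (g.1 0 0) + Polynomial.C (g.1 1 0) * Polynomial.X) ^ (n - (k : ℕ)) *
      (Polynomial.C (g.1 0 1) + Polynomial.C (g.1 1 1) * Polynomial.X) ^ (k : ℕ)).coeff m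

/-- The character `χ^{(j)}` of `SU(2)`. -/
def character (n : Spin) (g : SU2) : ℂ := (repMatrix n g).trace

/-- The matrix elements `I_{(m n)…;(p q)…}` of the Barrett–Crane intertwiner
`⨂_{r ∈ R} V_{(j_r, j_r*)} → ⨂_{s ∈ S} V_{(k_s, k_s*)}`: the integral over `S³` of the spherical
functions with the index pairs `a` of the codomain times the complex conjugates of those with the
index pairs `b` of the domain. -/
def bcIntertwiner {R S : Type*} [Fintype R] [Fintype S] (j : R → Spin) (k : S → Spin)
    (a : (s : S) → Fin (k s + 1) × Fin (k s + 1))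
    (b : (r : R) → Fin (j r + 1) × Fin (j r + 1)) : ℂ :=
  ∫ x, (starRingEnd ℂ) (∏ r, repMatrix (j r) x (b r).1 (b r).2) *
    ∏ s, repMatrix (k s) x (a s).1 (a s).2 ∂haarSU2

/-! ### Two-complexes with cyclic structure -/

/-- A 2-complex with cyclic structure.  Signs are elements of `ℤˣ = {1, -1}`; `bd 1 = ∂₊` is the
end point and `bd (-1) = ∂₋` the starting point of an edge.  The boundary edges of a face are
numbered by `Fin (N f)`, and `finRotate` is the cyclic successor. -/
structure CyclicComplex (V E F : Type*) where
  bd : ℤˣ → E → V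
  N : F → ℕ
  N_pos : ∀ f, 0 < N f
  edge : (f : F) → Fin (N f) → E
  sgn : (f : F) → Fin (N f) → ℤˣ
  closed : ∀ (f : F) (k : Fin (N f)),
    bd (-sgn f k) (edge f k) =
      bd (sgn f (finRotate (N f) k)) (edge f (finRotate (N f) k))

namespace CyclicComplex

variable {V E F : Type*} (X : CyclicComplex V E F)

/-- The boundary vertices `f₀` of a face, counted as often as the boundary path visits them, are
the corners `c : Fin (N f)`; the corner `c` is the vertex which the `c`-th boundary edge, followed
in the direction given by its sign, runs into. -/
def cornerVertex (f : F) (c : Fin (X.N f)) : V := X.bd (X.sgn f c) (X.edge f c)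

/-- The corner of `f` at the end `∂_σ e` of the `k`-th boundary edge `e` of `f`. -/
def cornerAt (f : F) (k : Fin (X.N f)) (σ : ℤˣ) : Fin (X.N f) :=
  if σ = X.sgn f k then k else finRotate (X.N f) k

theorem cornerVertex_cornerAt (f : F) (k : Fin (X.N f)) (σ : ℤˣ) :
    X.cornerVertex f (X.cornerAt f k σ) = X.bd σ (X.edge f k) := by
  unfold cornerVertex cornerAt
  split_ifs with h
  · rw [h]
  · rw [← X.closed f k]
    congr 1
    rcases Int.units_eq_one_or σ with h1 | h1 <;>
      rcases Int.units_eq_one_or (X.sgn f k) with h2 | h2 <;> simp_all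

/-- `e₊` (for `σ = 1`) and `e₋` (for `σ = -1`) with multiplicity: the occurrences `(f, k)` of the
edge `e` with sign `σ` in the boundaries of the faces. -/
abbrev Occ (e : E) (σ : ℤˣ) : Type _ :=
  {p : (f : F) × Fin (X.N f) // X.edge p.1 p.2 = e ∧ X.sgn p.1 p.2 = σ}

instance [Fintype F] (e : E) (σ : ℤˣ) : Fintype (X.Occ e σ) := Fintype.ofFinite _

open Classical in
/-- `δe`: the set of all faces that have the edge `e` in their boundary. -/
def cobd [Fintype F] (e : E) : Finset F :=
  Finset.univ.filter fun f => ∃ k, X.edge f k = e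

open Classical in
/-- `∂f`: the set of all edges in the boundary of the face `f`. -/
def bdEdges (f : F) : Finset E := Finset.univ.image (X.edge f)

/-! ### The Barrett–Crane model -/

variable [Fintype E] [Fintype F]

/-- The values of the indices `(n(f,v), m(f,v))`, one pair for each face and each of its corners. -/
abbrev Indices (j : F → Spin) : Type _ :=
  (f : F) → Fin (X.N f) → Fin (j f + 1) × Fin (j f + 1)

/-- The index pairs at the end `∂_σ e` of the edge `e`, for the faces in `e_τ`. -/
def indicesAt {j : F → Spin} (i : X.Indices j) (e : E) (σ τ : ℤˣ) (p : X.Occ e τ) :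
    Fin (j p.1.1 + 1) × Fin (j p.1.1 + 1) :=
  i p.1.1 (X.cornerAt p.1.1 p.1.2 σ)

/-- The intertwiner coefficient `I^{(+,e)}`, from the faces in `e₋` to those in `e₊`. -/
def interPlus {j : F → Spin} (i : X.Indices j) (e : E) : ℂ :=
  bcIntertwiner (fun p : X.Occ e (-1) => j p.1.1) (fun p : X.Occ e 1 => j p.1.1)
    (X.indicesAt i e 1 1) (X.indicesAt i e 1 (-1))

/-- The intertwiner coefficient `I^{(-,e)}`, from the faces in `e₊` to those in `e₋`. -/
def interMinus {j : F → Spin} (i : X.Indices j) (e : E) : ℂ :=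
  bcIntertwiner (fun p : X.Occ e 1 => j p.1.1) (fun p : X.Occ e (-1) => j p.1.1)
    (X.indicesAt i e (-1) (-1)) (X.indicesAt i e (-1) 1)

/-- An edge amplitude: for each edge `e` a function of the spins of the faces in `δe`. -/
abbrev EdgeAmplitude : Type _ := (e : E) → ({f : F // f ∈ X.cobd e} → Spin) → ℂ

open Classical in
/-- The contribution of the face colouring `j` to the partition function. -/
def bcTerm (w : Spin → ℂ) (A : X.EdgeAmplitude) (j : F → Spin) : ℂ :=
  (∏ f, w (j f)) * (∏ e, A e fun f => j f) *
    ∑ i : X.Indices j, ∏ e, X.interPlus i e * X.interMinus i e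

/-- The partition function of the Barrett–Crane model with face amplitude `w` and edge
amplitude `A`. -/
def partitionFunction (w : Spin → ℂ) (A : X.EdgeAmplitude) : ℂ :=
  ∑' j : F → Spin, X.bcTerm w A j

/-! ### The dual variables -/

/-- A pair `(g_e^{(+)}, g_e^{(-)})` for each edge. -/
abbrev Config (E : Type*) : Type _ := E → SU2 × SU2

/-- The product of the normalized Haar measures over all `g_e^{(+)}` and `g_e^{(-)}`. -/
def configMeasure (E : Type*) [Fintype E] : Measure (Config E) :=
  Measure.pi fun _ => haarSU2.prod haarSU2

/-- `g_e^{(σ)}` for a sign `σ`. -/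
def component (p : SU2 × SU2) (σ : ℤˣ) : SU2 := if σ = 1 then p.1 else p.2

/-- The variable `g^{(+)}_{v₊(f)}` at the corner `v = c` of the face `f`: it belongs to the boundary
edge that runs into the corner when the edge is followed in the direction given by its sign.  This
is `g_e^{(+)}` if the sign of `e` in `f` is `+1` (so that `v = ∂₊e`), and `g_e^{(-)}` otherwise. -/
def plusVar (g : Config E) (f : F) (c : Fin (X.N f)) : SU2 :=
  component (g (X.edge f c)) (X.sgn f c)

/-- The variable `g^{(-)}_{v₋(f)}` at the corner `v = c` of the face `f`: it belongs to the boundary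
edge that leaves the corner when the edge is followed in the direction given by its sign.  This
is `g_e^{(-)}` if the sign of `e` in `f` is `+1` (so that `v = ∂₋e`), and `g_e^{(+)}` otherwise. -/
def minusVar (g : Config E) (f : F) (c : Fin (X.N f)) : SU2 :=
  component (g (X.edge f ((finRotate (X.N f)).symm c))) (-X.sgn f ((finRotate (X.N f)).symm c))

/-- The contribution of the face colouring `j` to the integrand of the dual partition function. -/
def dualTerm (w : Spin → ℂ) (A : X.EdgeAmplitude) (j : F → Spin) (g : Config E) : ℂ :=
  (∏ e, A e fun f => j f) *
    ∏ f, (w (j f) * ∏ c, character (j f) (X.plusVar g f c * (X.minusVar g f c)⁻¹))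

/-- The arguments `(g_1^{(+)}, g_1^{(-)}, …, g_N^{(+)}, g_N^{(-)})` of the weight of the face `f`:
the pairs at its boundary edges, with the two members exchanged where the sign is `-1`. -/
def faceArgs (g : Config E) (f : F) (k : Fin (X.N f)) : SU2 × SU2 :=
  (component (g (X.edge f k)) (X.sgn f k), component (g (X.edge f k)) (-X.sgn f k))

/-- The contribution of the spin `j` to the local weight of the face `f`,
`w_j v_j^{|∂f|} χ^{(j)}(g_2^{(+)} (g_1^{(-)})⁻¹) ⋯ χ^{(j)}(g_1^{(+)} (g_N^{(-)})⁻¹)`. -/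
def weightTerm (w v : Spin → ℂ) (f : F) (j : Spin) (h : Fin (X.N f) → SU2 × SU2) : ℂ :=
  w j * v j ^ (X.bdEdges f).card *
    ∏ k, character j ((h (finRotate (X.N f) k)).1 * (h k).2⁻¹)

end CyclicComplex

/-! ### Sums of series of functions -/

/-- `S` is integrable and is the sum of the series `∑ i, u i` in the sense of unconditional
convergence in `L¹(μ)`. -/
def IsSumInL1 {α ι : Type*} [MeasurableSpace α] (μ : Measure α) (u : ι → α → ℂ) (S : α → ℂ) :
    Prop :=
  Integrable S μ ∧
    Tendsto (fun s : Finset ι => ∫⁻ x, ‖(∑ i ∈ s, u i x) - S x‖ₑ ∂μ) atTop (𝓝 0)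

/-- `S` is the sum of the series `∑ i, u i` in the sense of unconditional convergence
in measure. -/
def IsSumInMeasure {α ι : Type*} [MeasurableSpace α] (μ : Measure α) (u : ι → α → ℂ)
    (S : α → ℂ) : Prop :=
  TendstoInMeasure μ (fun (s : Finset ι) x => ∑ i ∈ s, u i x) atTop S

end BarrettCrane

end

/-
The matrix of `t^{(j)}` is conjugate to the symmetric power of `g` by the diagonal of the numbers
`√(n choose k)`, `n = 2j`, and these are exactly what turns the symmetric power of the adjoint into
the adjoint of the symmetric power.  So `t^{(j)}` is a unitary representation, and each character
`χ^{(j)}(g⁺ (g⁻)⁻¹) = ∑ t^{(j)}_{mn}(g⁺) \overline{t^{(j)}_{mn}(g⁻)}` is a sum over one index pair,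
so that a product of characters over all corners becomes a sum over one index pair per corner of
products of matrix elements.  Sorted by edges instead of corners, such a product splits into
functions of `(g_e⁺, g_e⁻)`, and the integral over this pair is `I^{(+,e)} I^{(-,e)}`.  Thus `Z` is
the termwise integral of the series `W`, and convergence in `L¹` allows termwise integration.

If the edge amplitude factorizes, the sum of the terms of `W` with all spins below `n` is the
product over the faces of the partial sums of the face weights.  These boxes exhaust all colourings
of the faces, and limits in measure are unique almost everywhere, so `W` is the product of the
`φ_f`.
-/

noncomputable section

namespace BarrettCrane

section SymPower

open Polynomial

variable {R : Type*} [CommSemiring R]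

theorem homogenize_pow {p : R[X]} {m : ℕ} (hp : p.natDegree ≤ m) (k : ℕ) :
    (p ^ k).homogenize (k * m) = p.homogenize m ^ k := by
  simpa using homogenize_finsetProd (s := Finset.range k) (p := fun _ => p) (n := fun _ => m)
    fun _ _ => hp

theorem aeval_homogenize {A : Type*} [CommSemiring A] [Algebra R A] (p : R[X]) (n : ℕ)
    (x : Fin 2 → A) :
    MvPolynomial.aeval x (p.homogenize n) =
      ∑ l : Fin (n + 1), p.coeff l • (x 1 ^ (n - l) * x 0 ^ (l : ℕ)) := by
  rw [homogenize, map_sum, Finset.Nat.sum_antidiagonal_eq_sum_range_succ_mk, Finset.sum_range]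
  refine Finset.sum_congr rfl fun l _ => ?_
  rw [MvPolynomial.aeval_monomial, Algebra.smul_def]
  simp [Finsupp.prod_fintype, Fin.prod_univ_two, Finsupp.update_apply, mul_comm (x 0 ^ _)]

theorem coeff_C_add_C_mul_X_pow (a b : R) (n k : ℕ) :
    ((C a + C b * X) ^ n).coeff k = a ^ (n - k) * n.choose k * b ^ k := by
  have hcomp : (C a + C b * X) ^ n = ((X + C a) ^ n).comp (C b * X) := by simp [add_comm]
  rw [hcomp, comp_C_mul_X_coeff, coeff_X_add_C_pow]

theorem coeff_coeff_swap (p : R[X][X]) (m k : ℕ) :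
    ((Bivariate.swap p).coeff m).coeff k = (p.coeff k).coeff m := by
  induction p using Polynomial.induction_on' with
  | add p q hp hq => simp only [map_add, coeff_add, hp, hq]
  | monomial i q =>
    induction q using Polynomial.induction_on' with
    | add p q hp hq => simp only [map_add, coeff_add, hp, hq]
    | monomial l r =>
      rw [Bivariate.swap_monomial_monomial]
      simp only [coeff_monomial]
      split_ifs <;> simp_all [coeff_monomial]

/-- The image of `x^(n-k) y^k` under the substitution `x ↦ M₀₀ x + M₁₀ y`, `y ↦ M₀₁ x + M₁₁ y`,
dehomogenized by `x = 1`, `y = X`. -/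
def substMonomial (n : ℕ) (M : Matrix (Fin 2) (Fin 2) R) (k : ℕ) : R[X] :=
  (C (M 0 0) + C (M 1 0) * X) ^ (n - k) * (C (M 0 1) + C (M 1 1) * X) ^ k

/-- The `n`-th symmetric power of a `2 × 2` matrix, in the basis `x^(n-k) y^k`, `0 ≤ k ≤ n`, of
the binary forms of degree `n`. -/
def symPower (n : ℕ) (M : Matrix (Fin 2) (Fin 2) R) : Matrix (Fin (n + 1)) (Fin (n + 1)) R :=
  Matrix.of fun m k => (substMonomial n M k).coeff m

theorem homogenize_substMonomial (n : ℕ) (M : Matrix (Fin 2) (Fin 2) R) (k : Fin (n + 1)) :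
    (substMonomial n M k).homogenize n =
      (MvPolynomial.C (M 0 0) * MvPolynomial.X 1 +
          MvPolynomial.C (M 1 0) * MvPolynomial.X 0) ^ (n - k : ℕ) *
        (MvPolynomial.C (M 0 1) * MvPolynomial.X 1 +
          MvPolynomial.C (M 1 1) * MvPolynomial.X 0) ^ (k : ℕ) := by
  have hdeg (a c : R) : (C a + C c * X).natDegree ≤ 1 := by compute_degree
  have hdeg_pow (a c : R) (d : ℕ) : ((C a + C c * X) ^ d).natDegree ≤ d := by
    simpa using natDegree_pow_le_of_le d (hdeg a c)
  have homogenize_linear_pow (a c : R) (d : ℕ) : ((C a + C c * X) ^ d).homogenize d =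
      (MvPolynomial.C a * MvPolynomial.X 1 + MvPolynomial.C c * MvPolynomial.X 0) ^ d := by
    simpa using homogenize_pow (hdeg a c) d
  have h := homogenize_mul _ _ (hdeg_pow (M 0 0) (M 1 0) (n - k)) (hdeg_pow (M 0 1) (M 1 1) k)
  rwa [Nat.sub_add_cancel k.is_le, homogenize_linear_pow, homogenize_linear_pow] at h

theorem substMonomial_mul (n : ℕ) (M M' : Matrix (Fin 2) (Fin 2) R) (k : Fin (n + 1)) :
    substMonomial n (M * M') k =
      ∑ l : Fin (n + 1), symPower n M' l k • substMonomial n M l := by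
  have h := aeval_homogenize (substMonomial n M' k) n
    ![C (M 0 1) + C (M 1 1) * X, C (M 0 0) + C (M 1 0) * X]
  rw [homogenize_substMonomial] at h
  refine Eq.trans ?_ h
  simp [substMonomial, Matrix.mul_apply, Fin.sum_univ_two]
  congr 2 <;> ring

theorem symPower_mul (n : ℕ) (M M' : Matrix (Fin 2) (Fin 2) R) :
    symPower n (M * M') = symPower n M * symPower n M' := by
  ext m k
  simp [symPower, substMonomial_mul, Matrix.mul_apply, finsetSum_coeff, mul_comm]

theorem symPower_map {S : Type*} [CommSemiring S] (φ : R →+* S) (n : ℕ)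
    (M : Matrix (Fin 2) (Fin 2) R) : symPower n (M.map φ) = (symPower n M).map φ := by
  ext m k
  simp [symPower, substMonomial, ← coeff_map]

-- The two sides are the coefficients of `X^m Y^k` and of `X^k Y^m` in the `n`-th powers of the
-- bilinear forms `(1, X) Mᵀ (1, Y)ᵀ` and `(1, X) M (1, Y)ᵀ`, which differ by exchanging `X`
-- and `Y`.
theorem choose_mul_symPower_transpose (n : ℕ) (M : Matrix (Fin 2) (Fin 2) R)
    (m k : Fin (n + 1)) :
    n.choose k * symPower n M.transpose m k = n.choose m * symPower n M k m := by
  let form (N : Matrix (Fin 2) (Fin 2) R) : R[X][X] :=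
    C (C (N 0 0) + C (N 1 0) * X) + C (C (N 0 1) + C (N 1 1) * X) * X
  have coeff_form (N : Matrix (Fin 2) (Fin 2) R) (m k : Fin (n + 1)) :
      ((form N ^ n).coeff k).coeff m = n.choose k * symPower n N m k := by
    rw [coeff_C_add_C_mul_X_pow, mul_right_comm, mul_comm, ← C_eq_natCast, coeff_C_mul]
    rfl
  have swap_form : Bivariate.swap (form M) = form M.transpose := by
    simp only [form, map_add, map_mul, Bivariate.swap_X, Bivariate.swap_Y, Bivariate.swap_C_C,
      Matrix.transpose_apply]
    ring
  rw [← coeff_form, ← coeff_form, ← swap_form, ← map_pow, coeff_coeff_swap]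

end SymPower

theorem choose_fin_pos {n : ℕ} (k : Fin (n + 1)) : (0 : ℝ) < n.choose k :=
  mod_cast Nat.choose_pos k.is_le

/-- The diagonal change of basis from the binary forms
`x^(n-k) y^k` to the orthonormal basis `√(n choose k) x^(n-k) y^k`. -/
def sqrtChoose (n : ℕ) : Matrix (Fin (n + 1)) (Fin (n + 1)) ℂ :=
  Matrix.diagonal fun k => (Real.sqrt (n.choose k) : ℂ)

theorem sqrt_choose_ne_zero {n : ℕ} (k : Fin (n + 1)) : (Real.sqrt (n.choose k) : ℂ) ≠ 0 :=
  Complex.ofReal_ne_zero.mpr (Real.sqrt_ne_zero'.mpr (choose_fin_pos k))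

theorem isUnit_sqrtChoose (n : ℕ) : IsUnit (sqrtChoose n) :=
  Matrix.isUnit_diagonal.mpr (Pi.isUnit_iff.mpr fun k => (sqrt_choose_ne_zero k).isUnit)

theorem sqrtChoose_mul_self (n : ℕ) :
    sqrtChoose n * sqrtChoose n =
      Matrix.diagonal fun k : Fin (n + 1) => (n.choose (k : ℕ) : ℂ) := by
  rw [sqrtChoose, Matrix.diagonal_mul_diagonal]
  simp [← Complex.ofReal_mul]

theorem conjTranspose_sqrtChoose (n : ℕ) : (sqrtChoose n).conjTranspose = sqrtChoose n := by
  rw [sqrtChoose, Matrix.diagonal_conjTranspose]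
  congr 1
  ext k
  simp

theorem sqrtChoose_mul_repMatrix (n : Spin) (g : SU2) :
    sqrtChoose n * repMatrix n g = symPower n g.1 * sqrtChoose n := by
  ext m k
  rw [sqrtChoose, Matrix.diagonal_mul, Matrix.mul_diagonal, repMatrix,
    Real.sqrt_div (choose_fin_pos k).le, Complex.ofReal_div, ← mul_assoc,
    mul_div_cancel₀ _ (sqrt_choose_ne_zero m), mul_comm]
  rfl

theorem repMatrix_mul (n : Spin) (g h : SU2) :
    repMatrix n (g * h) = repMatrix n g * repMatrix n h := by
  refine (isUnit_sqrtChoose n).mul_left_cancel ?_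
  calc sqrtChoose n * repMatrix n (g * h)
      = symPower n g.1 * symPower n h.1 * sqrtChoose n := by
        rw [sqrtChoose_mul_repMatrix, Submonoid.coe_mul, symPower_mul]
    _ = symPower n g.1 * sqrtChoose n * repMatrix n h := by
        rw [mul_assoc, ← sqrtChoose_mul_repMatrix, mul_assoc]
    _ = sqrtChoose n * (repMatrix n g * repMatrix n h) := by
        rw [← sqrtChoose_mul_repMatrix, mul_assoc]

theorem symPower_conjTranspose_mul (n : ℕ) (M : Matrix (Fin 2) (Fin 2) ℂ) :
    symPower n M.conjTranspose * (sqrtChoose n * sqrtChoose n) =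
      sqrtChoose n * sqrtChoose n * (symPower n M).conjTranspose := by
  ext m k
  have hmap : symPower n M.conjTranspose = (symPower n M.transpose).map (starRingEnd ℂ) :=
    symPower_map (starRingEnd ℂ) n M.transpose
  have h := congrArg (starRingEnd ℂ) (choose_mul_symPower_transpose n M m k)
  simp only [map_mul, map_natCast] at h
  rw [hmap, sqrtChoose_mul_self, Matrix.mul_diagonal, Matrix.diagonal_mul, mul_comm]
  exact h

theorem repMatrix_inv (n : Spin) (g : SU2) :
    repMatrix n g⁻¹ = (repMatrix n g).conjTranspose := by
  have hg : (g⁻¹).1 = g.1.conjTranspose := rfl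
  have hD := isUnit_sqrtChoose n
  have hadjoint : (repMatrix n g).conjTranspose * sqrtChoose n =
      sqrtChoose n * (symPower n g.1).conjTranspose := by
    simpa only [Matrix.conjTranspose_mul, conjTranspose_sqrtChoose] using
      congrArg Matrix.conjTranspose (sqrtChoose_mul_repMatrix n g)
  refine hD.mul_left_cancel (hD.mul_right_cancel ?_)
  calc sqrtChoose n * repMatrix n g⁻¹ * sqrtChoose n
      = symPower n g.1.conjTranspose * (sqrtChoose n * sqrtChoose n) := by
        rw [sqrtChoose_mul_repMatrix, hg, mul_assoc]
    _ = sqrtChoose n * (sqrtChoose n * (symPower n g.1).conjTranspose) := by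
        rw [symPower_conjTranspose_mul, mul_assoc]
    _ = sqrtChoose n * (repMatrix n g).conjTranspose * sqrtChoose n := by
        rw [← hadjoint, mul_assoc]

theorem character_mul_inv (n : Spin) (g h : SU2) :
    character n (g * h⁻¹) = ∑ p : Fin (n + 1) × Fin (n + 1),
      repMatrix n g p.1 p.2 * (starRingEnd ℂ) (repMatrix n h p.1 p.2) := by
  rw [character, repMatrix_mul, repMatrix_inv, Matrix.trace, Fintype.sum_prod_type]
  simp only [Matrix.diag_apply, Matrix.mul_apply, Matrix.conjTranspose_apply, starRingEnd_apply]

@[fun_prop]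
theorem continuous_repMatrix_apply (n : Spin) (m k : Fin (n + 1)) :
    Continuous fun g : SU2 => repMatrix n g m k := by
  have hentry (a b : Fin 2) : Continuous fun g : SU2 => g.1 a b :=
    (continuous_apply_apply a b).comp continuous_subtype_val
  have hlinear (a b : Fin 2) (d l : ℕ) : Continuous fun g : SU2 =>
      ((Polynomial.C (g.1 0 a) + Polynomial.C (g.1 1 b) * Polynomial.X) ^ d).coeff l := by
    simp only [coeff_C_add_C_mul_X_pow]
    exact (((hentry 0 a).pow _).mul continuous_const).mul ((hentry 1 b).pow _)
  simp only [repMatrix, Polynomial.coeff_mul]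
  exact continuous_const.mul (continuous_finsetSum _ fun x _ => (hlinear ..).mul (hlinear ..))

@[fun_prop]
theorem continuous_character (n : Spin) : Continuous (character n) := by
  unfold character Matrix.trace
  exact continuous_finsetSum _ fun i _ => continuous_repMatrix_apply n i i

instance : IsProbabilityMeasure haarSU2 :=
  ⟨Measure.haarMeasure_self (K₀ := (⊤ : TopologicalSpace.PositiveCompacts SU2))⟩

instance : SecondCountableTopology SU2 :=
  haveI : SecondCountableTopology (Matrix (Fin 2) (Fin 2) ℂ) :=
    inferInstanceAs (SecondCountableTopology (Fin 2 → Fin 2 → ℂ))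
  Topology.IsInducing.subtypeVal.secondCountableTopology

theorem integrable_of_continuous {α G : Type*} [TopologicalSpace α] [CompactSpace α]
    [MeasurableSpace α] [OpensMeasurableSpace α] [NormedAddCommGroup G]
    [SecondCountableTopologyEither α G] {μ : Measure α} [IsFiniteMeasureOnCompacts μ] {u : α → G}
    (hu : Continuous u) : Integrable u μ :=
  hu.integrable_of_hasCompactSupport (HasCompactSupport.of_compactSpace u)

namespace CyclicComplex

variable {V E F : Type*} (X : CyclicComplex V E F)

theorem cornerAt_sgn (f : F) (k : Fin (X.N f)) : X.cornerAt f k (X.sgn f k) = k :=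
  if_pos rfl

theorem cornerAt_neg_sgn (f : F) (k : Fin (X.N f)) :
    X.cornerAt f k (-X.sgn f k) = finRotate (X.N f) k :=
  if_neg (units_ne_neg_self (X.sgn f k)).symm

theorem minusVar_finRotate (g : Config E) (f : F) (k : Fin (X.N f)) :
    X.minusVar g f (finRotate (X.N f) k) = component (g (X.edge f k)) (-X.sgn f k) := by
  simp only [minusVar, Equiv.symm_apply_apply]

@[fun_prop]
theorem continuous_component (σ : ℤˣ) : Continuous fun p : SU2 × SU2 => component p σ := by
  unfold component
  split_ifs
  exacts [continuous_fst, continuous_snd]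

/-- The factor which the occurrence `p = (f, k)` of an edge contributes to the expansion of the
product of all characters into matrix elements, as a function of the pair of variables of that
edge.  It collects `t^{(j_f)}` from the corner of `f` which the edge runs into and the conjugate of
`t^{(j_f)}` from the corner which it leaves. -/
def occFactor {j : F → Spin} (i : X.Indices j) (p : (f : F) × Fin (X.N f)) (x : SU2 × SU2) : ℂ :=
  repMatrix (j p.1) (component x (X.sgn p.1 p.2))
      (i p.1 (X.cornerAt p.1 p.2 (X.sgn p.1 p.2))).1
      (i p.1 (X.cornerAt p.1 p.2 (X.sgn p.1 p.2))).2 *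
    (starRingEnd ℂ) (repMatrix (j p.1) (component x (-X.sgn p.1 p.2))
      (i p.1 (X.cornerAt p.1 p.2 (-X.sgn p.1 p.2))).1
      (i p.1 (X.cornerAt p.1 p.2 (-X.sgn p.1 p.2))).2)

@[fun_prop]
theorem continuous_occFactor {j : F → Spin} (i : X.Indices j) (p : (f : F) × Fin (X.N f)) :
    Continuous (X.occFactor i p) := by
  unfold occFactor
  fun_prop

theorem occFactor_of_sgn_eq {j : F → Spin} (i : X.Indices j) {e : E} {σ : ℤˣ} (p : X.Occ e σ)
    (x : SU2 × SU2) :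
    X.occFactor i p.1 x =
      repMatrix (j p.1.1) (component x σ) (X.indicesAt i e σ σ p).1 (X.indicesAt i e σ σ p).2 *
        (starRingEnd ℂ) (repMatrix (j p.1.1) (component x (-σ))
          (X.indicesAt i e (-σ) σ p).1 (X.indicesAt i e (-σ) σ p).2) := by
  simp only [occFactor, indicesAt, p.2.2]

variable [Fintype F]

open Classical in
theorem prod_character_eq_sum (j : F → Spin) (g : Config E) :
    ∏ f, ∏ c, character (j f) (X.plusVar g f c * (X.minusVar g f c)⁻¹) =
      ∑ i : X.Indices j, ∏ p : (f : F) × Fin (X.N f), X.occFactor i p (g (X.edge p.1 p.2)) := by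
  simp only [character_mul_inv, Finset.prod_univ_sum, Fintype.piFinset_univ]
  refine Finset.sum_congr rfl fun i _ => ?_
  rw [Fintype.prod_sigma]
  refine Finset.prod_congr rfl fun f _ => ?_
  simp only [occFactor, cornerAt_sgn, cornerAt_neg_sgn, Finset.prod_mul_distrib]
  -- A corner carries the `g⁺` of the edge running into it and the `g⁻` of the preceding edge, so
  -- the conjugated factors have to be rotated by one to be sorted by edges.
  congr 1
  rw [← Equiv.prod_comp (finRotate (X.N f))]
  simp only [minusVar_finRotate]

theorem integral_prod_occFactor_edge {j : F → Spin} (i : X.Indices j) (e : E) :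
    ∫ x, (∏ p : X.Occ e 1, X.occFactor i p.1 x) * ∏ p : X.Occ e (-1), X.occFactor i p.1 x
        ∂haarSU2.prod haarSU2 =
      X.interPlus i e * X.interMinus i e := by
  rw [interPlus, interMinus, bcIntertwiner, bcIntertwiner, ← integral_prod_mul]
  refine integral_congr_ae (Eventually.of_forall fun x => ?_)
  simp only [occFactor_of_sgn_eq, Finset.prod_mul_distrib, map_prod]
  simp only [component, ↓reduceIte, neg_units_ne_self, neg_neg]
  ring

variable [Fintype E]

instance : IsProbabilityMeasure (configMeasure E) := by
  unfold configMeasure; infer_instance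

theorem prod_eq_prod_occ {M : Type*} [CommMonoid M] (a : (f : F) × Fin (X.N f) → M) :
    ∏ p, a p = ∏ e, (∏ p : X.Occ e 1, a p.1) * ∏ p : X.Occ e (-1), a p.1 := by
  classical
  rw [← Finset.prod_fiberwise Finset.univ (fun p => X.edge p.1 p.2)]
  refine Finset.prod_congr rfl fun e _ => ?_
  rw [← Finset.prod_filter_mul_prod_filter_not _ (fun p => X.sgn p.1 p.2 = 1)]
  congr 1
  · exact Finset.prod_subtype _ (by simp) a
  · exact Finset.prod_subtype _ (by simp [Int.units_ne_iff_eq_neg]) a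

theorem prod_occFactor_eq_prod_edge {j : F → Spin} (i : X.Indices j) (g : Config E) :
    ∏ p : (f : F) × Fin (X.N f), X.occFactor i p (g (X.edge p.1 p.2)) =
      ∏ e, (∏ p : X.Occ e 1, X.occFactor i p.1 (g e)) *
        ∏ p : X.Occ e (-1), X.occFactor i p.1 (g e) := by
  have hedge {e : E} {σ : ℤˣ} (p : X.Occ e σ) : X.edge p.1.1 p.1.2 = e := p.2.1
  simp only [prod_eq_prod_occ, hedge]

theorem integral_prod_occFactor {j : F → Spin} (i : X.Indices j) :
    ∫ g, ∏ p : (f : F) × Fin (X.N f), X.occFactor i p (g (X.edge p.1 p.2)) ∂configMeasure E =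
      ∏ e, X.interPlus i e * X.interMinus i e := by
  simp only [prod_occFactor_eq_prod_edge, configMeasure]
  rw [integral_fintype_prod_eq_prod (f := fun e x => (∏ p : X.Occ e 1, X.occFactor i p.1 x) *
    ∏ p : X.Occ e (-1), X.occFactor i p.1 x)]
  simp only [integral_prod_occFactor_edge]

theorem continuous_dualTerm (w : Spin → ℂ) (A : X.EdgeAmplitude) (j : F → Spin) :
    Continuous (X.dualTerm w A j) := by
  unfold dualTerm plusVar minusVar
  fun_prop

theorem integral_dualTerm (w : Spin → ℂ) (A : X.EdgeAmplitude) (j : F → Spin) :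
    ∫ g, X.dualTerm w A j g ∂configMeasure E = X.bcTerm w A j := by
  have hintegrable (i : X.Indices j) : Integrable (fun g : Config E =>
      ∏ p : (f : F) × Fin (X.N f), X.occFactor i p (g (X.edge p.1 p.2))) (configMeasure E) :=
    integrable_of_continuous (by fun_prop)
  simp only [dualTerm, Finset.prod_mul_distrib, prod_character_eq_sum]
  rw [integral_const_mul, integral_const_mul, integral_finsetSum _ fun i _ => hintegrable i]
  simp only [integral_prod_occFactor]
  rw [bcTerm]
  ring

theorem prod_prod_cobd {M : Type*} [CommMonoid M] (a : F → M) :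
    ∏ e, ∏ f : {f : F // f ∈ X.cobd e}, a f = ∏ f, a f ^ (X.bdEdges f).card := by
  simp only [Finset.prod_coe_sort (X.cobd _) a]
  rw [Finset.prod_comm' (t' := Finset.univ) (s' := X.bdEdges) (by simp [cobd, bdEdges])]
  simp only [Finset.prod_const]

theorem dualTerm_eq_prod_weightTerm {w v : Spin → ℂ} {A : X.EdgeAmplitude}
    (hA : ∀ (e : E) (j : {f : F // f ∈ X.cobd e} → Spin), A e j = ∏ f, v (j f))
    (j : F → Spin) (g : Config E) :
    X.dualTerm w A j g = ∏ f, X.weightTerm w v f (j f) (X.faceArgs g f) := by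
  simp only [dualTerm, hA, weightTerm]
  rw [X.prod_prod_cobd fun f => v (j f), ← Finset.prod_mul_distrib]
  refine Finset.prod_congr rfl fun f _ => ?_
  rw [← Equiv.prod_comp (finRotate (X.N f))]
  simp only [minusVar_finRotate, plusVar, faceArgs]
  ring

end CyclicComplex

theorem tendsto_piFinset_atTop {α ι : Type*} [Fintype ι] [DecidableEq ι] {κ : ι → Type*}
    {l : Filter α} {s : α → (i : ι) → Finset (κ i)}
    (h : ∀ i, Tendsto (fun a => s a i) l atTop) :
    Tendsto (fun a => Fintype.piFinset (s a)) l atTop := by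
  classical
  refine tendsto_atTop.mpr fun t => ?_
  filter_upwards [eventually_all.mpr fun i =>
    (h i).eventually_ge_atTop (t.image fun j => j i)] with a ha j hj
  exact Fintype.mem_piFinset.mpr fun i => ha i (Finset.mem_image_of_mem _ hj)

section Convergence

variable {α ι E E' : Type*} [MeasurableSpace α] {μ : Measure α}

theorem tendstoInMeasure_pi {κ : Type*} [Fintype ι] [PseudoEMetricSpace E] {l : Filter κ}
    {u : κ → α → ι → E} {S : α → ι → E}
    (h : ∀ i, TendstoInMeasure μ (fun n x => u n x i) l fun x => S x i) :
    TendstoInMeasure μ u l S := by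
  intro ε hε
  have hsubset (n : κ) : {x | ε ≤ edist (u n x) (S x)} ⊆
      ⋃ i, {x | ε ≤ edist (u n x i) (S x i)} := by
    intro x hx
    by_contra! hlt
    simp only [Set.mem_iUnion, Set.mem_ofPred_eq, not_exists, not_le] at hlt
    exact (Finset.sup_lt_iff hε).mpr (fun i _ => hlt i) |>.not_ge hx
  have hsum : Tendsto (fun n => ∑ i, μ {x | ε ≤ edist (u n x i) (S x i)}) l (𝓝 0) := by
    simpa using tendsto_finsetSum Finset.univ fun i _ => h i ε hε
  exact tendsto_of_tendsto_of_tendsto_of_le_of_le tendsto_const_nhds hsum (fun _ => zero_le)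
    fun n => (measure_mono (hsubset n)).trans (measure_iUnion_fintype_le μ _)

theorem ae_eq_comp_of_tendstoInMeasure [PseudoEMetricSpace E] [EMetricSpace E']
    {u : ℕ → α → E} {T : α → E} {S : α → E'} {Φ : E → E'} (hΦ : Continuous Φ)
    (hu : TendstoInMeasure μ u atTop T)
    (hΦu : TendstoInMeasure μ (fun n x => Φ (u n x)) atTop S) :
    S =ᵐ[μ] fun x => Φ (T x) := by
  obtain ⟨ns, hns, hT⟩ := hu.exists_seq_tendsto_ae
  obtain ⟨ms, hms, hS⟩ := (hΦu.comp hns.tendsto_atTop).exists_seq_tendsto_ae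
  filter_upwards [hT, hS] with x hTx hSx
  exact tendsto_nhds_unique hSx ((hΦ.tendsto _).comp (hTx.comp hms.tendsto_atTop))

theorem IsSumInL1.hasSum_integral {u : ι → α → ℂ} {S : α → ℂ} (hS : IsSumInL1 μ u S)
    (hu : ∀ i, Integrable (u i) μ) : HasSum (fun i => ∫ x, u i x ∂μ) (∫ x, S x ∂μ) := by
  have h := tendsto_integral_of_L1 S hS.1.aestronglyMeasurable
    (Eventually.of_forall fun s : Finset ι => integrable_finsetSum s fun i _ => hu i) hS.2
  simp only [integral_finsetSum _ fun i _ => hu i] at h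
  exact h

theorem IsSumInL1.isSumInMeasure {u : ι → α → ℂ} {S : α → ℂ} (hS : IsSumInL1 μ u S)
    (hu : ∀ i, AEStronglyMeasurable (u i) μ) : IsSumInMeasure μ u S := by
  refine tendstoInMeasure_of_tendsto_eLpNorm one_ne_zero
    (fun s => Finset.aestronglyMeasurable_fun_sum s fun i _ => hu i)
    hS.1.aestronglyMeasurable ?_
  simpa only [eLpNorm_one_eq_lintegral_enorm, Pi.sub_apply] using hS.2

theorem IsSumInMeasure.ae_eq_prod [Fintype ι] {u : ι → ℕ → α → ℂ} {S : α → ℂ} {T : ι → α → ℂ}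
    (hS : IsSumInMeasure μ (fun (j : ι → ℕ) x => ∏ i, u i (j i) x) S)
    (hT : ∀ i, TendstoInMeasure μ (fun n x => ∑ k ∈ Finset.range n, u i k x) atTop (T i)) :
    S =ᵐ[μ] fun x => ∏ i, T i x := by
  classical
  have hbox : Tendsto (fun n => Fintype.piFinset fun _ : ι => Finset.range n) atTop atTop :=
    tendsto_piFinset_atTop fun _ => tendsto_finset_range
  have hprod : TendstoInMeasure μ (fun n x => ∏ i, ∑ k ∈ Finset.range n, u i k x) atTop S := by
    simpa only [Finset.prod_univ_sum, Function.comp_def] using hS.comp hbox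
  exact ae_eq_comp_of_tendstoInMeasure (Φ := fun z : ι → ℂ => ∏ i, z i) (by fun_prop)
    (tendstoInMeasure_pi (S := fun x i => T i x) hT) hprod

end Convergence

end BarrettCrane

end

open BarrettCrane CyclicComplex in
theorem theorem2_general {V E F : Type*} [Fintype E] [Fintype F]
    (X : CyclicComplex V E F) (w : Spin → ℂ) (A : X.EdgeAmplitude)
    (W : Config E → ℂ) (hW : IsSumInL1 (configMeasure E) (X.dualTerm w A) W) :
    (Summable (X.bcTerm w A) ∧
      X.partitionFunction w A = ∫ g, W g ∂configMeasure E) ∧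
    ∀ v : Spin → ℂ,
      (∀ (e : E) (j : {f : F // f ∈ X.cobd e} → Spin), A e j = ∏ f, v (j f)) →
      ∀ φ : (f : F) → (Fin (X.N f) → SU2 × SU2) → ℂ,
        (∀ f, TendstoInMeasure (configMeasure E)
          (fun n g => ∑ j ∈ Finset.range n, X.weightTerm w v f j (X.faceArgs g f)) atTop
          (fun g => φ f (X.faceArgs g f))) →
        Integrable (fun g => ∏ f, φ f (X.faceArgs g f)) (configMeasure E) ∧
        X.partitionFunction w A = ∫ g, ∏ f, φ f (X.faceArgs g f) ∂configMeasure E := by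
  have hintegrable (j : F → Spin) : Integrable (X.dualTerm w A j) (configMeasure E) :=
    integrable_of_continuous (X.continuous_dualTerm w A j)
  have hsum : HasSum (X.bcTerm w A) (∫ g, W g ∂configMeasure E) := by
    simpa only [integral_dualTerm] using hW.hasSum_integral hintegrable
  refine ⟨⟨hsum.summable, hsum.tsum_eq⟩, fun v hA φ hφ => ?_⟩
  have hlocal : W =ᵐ[configMeasure E] fun g => ∏ f, φ f (X.faceArgs g f) := by
    have hmeasure := hW.isSumInMeasure fun j => (hintegrable j).aestronglyMeasurable
    have hterm : X.dualTerm w A = fun j g => ∏ f, X.weightTerm w v f (j f) (X.faceArgs g f) :=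
      funext₂ (X.dualTerm_eq_prod_weightTerm hA)
    rw [hterm] at hmeasure
    exact hmeasure.ae_eq_prod (u := fun f j g => X.weightTerm w v f j (X.faceArgs g f)) hφ
  exact ⟨hW.1.congr hlocal, hsum.tsum_eq.trans (integral_congr_ae hlocal)⟩

open BarrettCrane CyclicComplex in
theorem theorem2 {V E F : Type*} [Finite V] [Fintype E] [Fintype F]
    (X : CyclicComplex V E F) (w : Spin → ℂ) (A : X.EdgeAmplitude)
    (W : Config E → ℂ) (hW : IsSumInL1 (configMeasure E) (X.dualTerm w A) W) :
    (Summable (X.bcTerm w A) ∧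
      X.partitionFunction w A = ∫ g, W g ∂configMeasure E) ∧
    ∀ v : Spin → ℂ,
      (∀ (e : E) (j : {f : F // f ∈ X.cobd e} → Spin), A e j = ∏ f, v (j f)) →
      ∀ φ : (f : F) → (Fin (X.N f) → SU2 × SU2) → ℂ,
        (∀ f, IsSumInMeasure (configMeasure E)
          (fun j g => X.weightTerm w v f j (X.faceArgs g f)) (fun g => φ f (X.faceArgs g f))) →
        Integrable (fun g => ∏ f, φ f (X.faceArgs g f)) (configMeasure E) ∧
        X.partitionFunction w A = ∫ g, ∏ f, φ f (X.faceArgs g f) ∂configMeasure E := by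
  obtain ⟨hZ, hlocal⟩ := theorem2_general X w A W hW
  exact ⟨hZ, fun v hA φ hφ => hlocal v hA φ fun f => (hφ f).comp tendsto_finset_range⟩
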